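/- A (finite) Markov decision process consists of a finite set $S$ of states, a finite nonempty set $A(s)$ of actions for each $s \in S$, a payoff function $r : SA \to \mathbb{R}$ and a transition function $q : SA \to \Delta(S)$, where $SA = \{(s,a) : s \in S, a \in A(s)\}$ and $\Delta(X)$ is the set of probability distributions over $X$. A behavior strategy $\sigma$ assigns to every finite history $(s_1,a_1,\dots,s_{n-1},a_{n-1},s_n) \in (SA)^{n-1} \times S$, $n \ge 1$, a probability distribution over $A(s_n)$. Together with a prior $\mu \in \Delta(S)$ of the initial state $s_1$ it induces a probability distribution over the infinite histories $(s_1,a_1,s_2,a_2,\dots)$, with expectation $\mathbb{E}_{\mu,\sigma}$. For $\lambda \in [0,1)$ the $\lambda$-discounted value is $$v_\lambda(\mu) = \sup_{\sigma} \mathbb{E}_{\mu,\sigma}\Big[\sum_{n=1}^\infty \lambda^{n-1} r(s_n,a_n)\Big],$$ where the supremum is over all behavior strategies. **Theorem 1.** For a function $w : [0,1) \to \mathbb{R}$ the following are equivalent. 1. There are a finite Markov decision process and a prior $\mu$ such that $w(\lambda) = v_\lambda(\mu)$ for every $\lambda \in [0,1)$. 2. The function $w$ is the pointwise maximum on $[0,1)$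 of a nonempty finite set of functions of the form $P/Q$, where $P$ and $Q \neq 0$ are polynomials with real coefficients and each root $z \in \mathbb{C}$ of $Q$ either lies outside the unit ball ($|z| > 1$), or is a root of unity ($z^n = 1$ for some integer $n \ge 1$) and has multiplicity 1 as a root of $Q$. -/

import Mathlib

noncomputable section

/-- A finite Markov decision process: a finite set `S` of states, a finite nonempty set `A s` of
actions available at each state `s`, a real payoff `r s a` and a transition law `q s a`, which is
a probability distribution over `S`. The prior over the initial state is kept separate. -/
structure MDP where
  S : Type
  A : S → Type
  [finS : Fintype S]
  [finA : ∀ s, Fintype (A s)]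
  [neA : ∀ s, Nonempty (A s)]
  r : (s : S) → A s → ℝ
  q : (s : S) → A s → PMF S

namespace MDP

attribute [instance] MDP.finS MDP.finA MDP.neA

/-- The set of state-action pairs. -/
abbrev SA (M : MDP) : Type := (s : M.S) × M.A s

instance (M : MDP) (s : M.S) : MeasurableSpace (M.A s) := ⊤

instance (M : MDP) (s : M.S) : DiscreteMeasurableSpace (M.A s) := ⟨fun _ => trivial⟩

instance (M : MDP) : DiscreteMeasurableSpace M.SA :=
  ⟨fun _ => MeasurableSpace.measurableSet_iInf.2 fun _ => trivial⟩

/-- A behavior strategy. Stages are numbered from `0`: at stage `n`, given the `n` state-action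
pairs of the previous stages and the current state `s`, it selects a mixed action over `A s`. -/
def BehaviorStrategy (M : MDP) : Type :=
  (n : ℕ) → (Fin n → M.SA) → (s : M.S) → PMF (M.A s)

/-- The law of the state-action pair at stage `n`, given the past `h` of that stage, when the
current state has law `p`. -/
def stageLaw (M : MDP) (σ : M.BehaviorStrategy) (n : ℕ) (h : Fin n → M.SA) (p : PMF M.S) :
    PMF M.SA :=
  p.bind fun s => (σ n h s).map fun a => ⟨s, a⟩

/-- The law of the state-action pair at stage `n + 1`, as a function of the state-action pairs at
stages `0, …, n`: the new state is drawn from `q`, the new action from the strategy. -/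
def stepKernel (M : MDP) (σ : M.BehaviorStrategy) (n : ℕ) :
    ProbabilityTheory.Kernel (Finset.Iic n → M.SA) M.SA where
  toFun h :=
    (M.stageLaw σ (n + 1)
      (fun i => h ⟨(i : ℕ), Finset.mem_Iic.2 (Nat.lt_succ_iff.1 i.isLt)⟩)
      (M.q (h ⟨n, Finset.mem_Iic.2 le_rfl⟩).1 (h ⟨n, Finset.mem_Iic.2 le_rfl⟩).2)).toMeasure
  measurable' := Measurable.of_discrete

instance (M : MDP) (σ : M.BehaviorStrategy) (n : ℕ) :
    ProbabilityTheory.IsMarkovKernel (M.stepKernel σ n) :=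
  ⟨fun _ => PMF.toMeasure.isProbabilityMeasure _⟩

/-- The probability distribution over the space of infinite histories that is induced by the
prior `μ` and the behavior strategy `σ`. -/
def pathMeasure (M : MDP) (μ : PMF M.S) (σ : M.BehaviorStrategy) :
    MeasureTheory.Measure (ℕ → M.SA) :=
  ProbabilityTheory.Kernel.trajMeasure (X := fun _ => M.SA)
    (M.stageLaw σ 0 Fin.elim0 μ).toMeasure (M.stepKernel σ)

/-- The discounted payoff: the expected total discounted payoff under `μ` and `σ`. -/
def discountedPayoff (M : MDP) (l : ℝ) (μ : PMF M.S) (σ : M.BehaviorStrategy) : ℝ :=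
  ∫ h, ∑' n : ℕ, l ^ n * M.r (h n).1 (h n).2 ∂(M.pathMeasure μ σ)

/-- The discounted value: the supremum of the discounted payoff over all behavior strategies. -/
def discountedValue (M : MDP) (l : ℝ) (μ : PMF M.S) : ℝ :=
  ⨆ σ : M.BehaviorStrategy, M.discountedPayoff l μ σ

end MDP

/-- The set of value functions, on `[0, 1)`, of Markov decision processes with some prior. -/
def valueFunctions : Set (Set.Ico (0 : ℝ) 1 → ℝ) :=
  {w | ∃ (M : MDP) (μ : PMF M.S), ∀ l : Set.Ico (0 : ℝ) 1, w l = M.discountedValue l μ}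

/-- The functions on `[0, 1)` given by a rational function `P / Q` with real coefficients such
that each complex root of `Q` either lies outside the (closed) unit ball or is a root of unity
and has multiplicity `1` as a root of `Q`. -/
def admissibleRationalFunctions : Set (Set.Ico (0 : ℝ) 1 → ℝ) :=
  {f | ∃ P Q : Polynomial ℝ, Q ≠ 0 ∧
    (∀ z : ℂ, (Q.map (algebraMap ℝ ℂ)).IsRoot z →
      1 < ‖z‖ ∨
      ((∃ n : ℕ, 0 < n ∧ z ^ n = 1) ∧ (Q.map (algebraMap ℝ ℂ)).rootMultiplicity z = 1)) ∧
    ∀ l : Set.Ico (0 : ℝ) 1, f l = P.eval (l : ℝ) / Q.eval (l : ℝ)}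

/-- The pointwise maxima of nonempty finite sets of functions as above. -/
def maxAdmissibleRationalFunctions : Set (Set.Ico (0 : ℝ) 1 → ℝ) :=
  {w | ∃ (F : Finset (Set.Ico (0 : ℝ) 1 → ℝ)) (hF : F.Nonempty),
    (∀ f ∈ F, f ∈ admissibleRationalFunctions) ∧
    ∀ l : Set.Ico (0 : ℝ) 1, w l = F.sup' hF fun f => f l}

end

/-!
A function on `[0, 1)` is the discounted value of a finite Markov decision process if and only if it
is a maximum of finitely many admissible rational functions.

*Values are maxima of admissible functions.* For a fixed discount factor `l`, a potential `U` on the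
states and any strategy, the discounted payoff equals the expectation of `U` at the initial state
plus the discounted sum of the expected Bellman gaps `r + l * q U - U`, because the potentials of
the later states telescope (`MDP.hasSum_bellmanGap`). Applied to the fixed point of the Bellman
operator, this shows that the value is the maximum of the payoffs of the finitely many pure
stationary strategies (`MDP.discountedValue_eq_sup'`). The payoff of such a strategy is governed by
the resolvent `(1 - l A)⁻¹` of a stochastic matrix `A`, whose denominator can be taken to be the
reverse of the minimal polynomial of `A`. Its roots are the inverses of the nonzero eigenvalues. An
eigenvalue has modulus at most one; an eigenvalue of modulus one is a root of unity, since it acts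
on the finite set of the values of maximal modulus of an eigenvector, and it is a simple root of the
minimal polynomial, since the powers of `A` are bounded
(`Matrix.admissibleDenominator_reverse_minpoly`).

*Maxima of admissible functions are values.* A state whose actions select one of finitely many
Markov chains realizes maxima, so it suffices to realize an admissible `P / Q` by a Markov chain.
The functions so realized form a module over the polynomials (`chainPayoffs`), and they include
`1 / (1 - b)` whenever `b` has no constant term and the moduli of its coefficients add up to at most
one: such a function solves `f = 1 + ∑ k, b_k l ^ k f`, and the moduli of the `b_k` serve as
transition probabilities (`inv_one_sub_eval_mem_chainPayoffs`). The denominator `Q` divides a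
product `(X ^ n - 1) * (1 - b)`, where `X ^ n - 1` absorbs the simple roots of unity and `1 - b`,
with small `b`, the roots outside the disc, as `X - z` divides `1 - (X / z) ^ N` for all `N`
(`AdmissibleDenominator.exists_dvd`). The two factors are coprime, and partial fractions conclude.
-/

noncomputable section

open MeasureTheory ProbabilityTheory Polynomial

/-! ### Expectations under distributions on finite sets -/

namespace PMF

variable {α β : Type*} [Fintype α] [Fintype β]

/-- The expectation of a real function under a probability distribution on a finite type. -/
def expect (p : PMF α) (f : α → ℝ) : ℝ := ∑ a, (p a).toReal * f a

lemma sum_toReal (p : PMF α) : ∑ a, (p a).toReal = 1 := by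
  rw [← ENNReal.toReal_sum fun a _ => p.apply_ne_top a, ← tsum_fintype (L := .unconditional _),
    p.tsum_coe, ENNReal.toReal_one]

@[simp] lemma expect_const (p : PMF α) (c : ℝ) : p.expect (fun _ => c) = c := by
  simp [expect, ← Finset.sum_mul, sum_toReal]

@[simp] lemma expect_pure (a : α) (f : α → ℝ) : (PMF.pure a).expect f = f a := by
  classical
  rw [expect, Finset.sum_eq_single a] <;> simp +contextual [PMF.pure_apply]

lemma expect_bind (p : PMF α) (k : α → PMF β) (f : β → ℝ) :
    (p.bind k).expect f = p.expect fun a => (k a).expect f := by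
  have h : ∀ b, ((p.bind k) b).toReal = ∑ a, (p a).toReal * (k a b).toReal := fun b => by
    rw [PMF.bind_apply, tsum_fintype, ENNReal.toReal_sum]
    · simp
    · exact fun a _ => ENNReal.mul_ne_top (p.apply_ne_top a) ((k a).apply_ne_top b)
  simp only [expect, h, Finset.sum_mul, Finset.mul_sum]
  rw [Finset.sum_comm]
  simp only [mul_assoc]

@[simp] lemma expect_map (p : PMF α) (g : α → β) (f : β → ℝ) :
    (p.map g).expect f = p.expect fun a => f (g a) := by
  rw [← PMF.bind_pure_comp, expect_bind]; simp

lemma expect_mono (p : PMF α) {f g : α → ℝ} (h : ∀ a, f a ≤ g a) : p.expect f ≤ p.expect g :=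
  Finset.sum_le_sum fun a _ => mul_le_mul_of_nonneg_left (h a) ENNReal.toReal_nonneg

lemma expect_add (p : PMF α) (f g : α → ℝ) :
    p.expect (fun a => f a + g a) = p.expect f + p.expect g := by
  simp [expect, mul_add, Finset.sum_add_distrib]

lemma expect_const_mul (p : PMF α) (c : ℝ) (f : α → ℝ) :
    p.expect (fun a => c * f a) = c * p.expect f := by
  simp [expect, Finset.mul_sum, mul_left_comm]

lemma integral_toMeasure [MeasurableSpace α] [MeasurableSingletonClass α] (p : PMF α)
    (f : α → ℝ) : ∫ a, f a ∂p.toMeasure = p.expect f := by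
  rw [PMF.integral_eq_sum]; rfl

end PMF

/-! ### Discounted payoffs through the Bellman equation -/

namespace MDP

variable (M : MDP) (μ : PMF M.S) (σ : M.BehaviorStrategy)

lemma stageLaw_expect (n : ℕ) (h : Fin n → M.SA) (p : PMF M.S) (g : M.SA → ℝ) :
    (M.stageLaw σ n h p).expect g = p.expect fun s => (σ n h s).expect fun a => g ⟨s, a⟩ := by
  simp [stageLaw, PMF.expect_bind]

instance : IsProbabilityMeasure (M.stageLaw σ 0 Fin.elim0 μ).toMeasure :=
  PMF.toMeasure.isProbabilityMeasure _

instance : IsProbabilityMeasure (M.pathMeasure μ σ) := by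
  unfold pathMeasure; infer_instance

lemma integrable_stage (n : ℕ) (g : M.SA → ℝ) :
    Integrable (fun h => g (h n)) (M.pathMeasure μ σ) := by
  obtain ⟨C, hC⟩ := (Set.finite_range fun x => ‖g x‖).bddAbove
  refine Integrable.of_bound (Measurable.of_discrete.comp
    (measurable_pi_apply n)).aestronglyMeasurable C (.of_forall fun h => hC ⟨h n, rfl⟩)

lemma integral_stage_zero (g : M.SA → ℝ) :
    ∫ h, g (h 0) ∂(M.pathMeasure μ σ) = (M.stageLaw σ 0 Fin.elim0 μ).expect g := by
  have key : (M.pathMeasure μ σ).map (Preorder.frestrictLe 0) =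
      (M.stageLaw σ 0 Fin.elim0 μ).toMeasure.map
        (MeasurableEquiv.piUnique (fun _ : Finset.Iic 0 => M.SA)).symm := by
    rw [pathMeasure, Kernel.trajMeasure, Measure.map_comp _ _ (by fun_prop),
      Kernel.traj_map_frestrictLe, Kernel.partialTraj_self, Measure.id_comp]
  have h1 : ∫ h, g (h 0) ∂(M.pathMeasure μ σ) =
      ∫ y, g (y ⟨0, Finset.mem_Iic.2 le_rfl⟩)
        ∂((M.pathMeasure μ σ).map (Preorder.frestrictLe (π := fun _ => M.SA) 0)) := by
    rw [integral_map (by fun_prop) Measurable.of_discrete.aestronglyMeasurable]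
    rfl
  rw [h1, key, integral_map (MeasurableEquiv.measurable _).aemeasurable
    Measurable.of_discrete.aestronglyMeasurable, ← PMF.integral_toMeasure]
  rfl

lemma integral_stage_succ (n : ℕ) (g : M.SA → ℝ) :
    ∫ h, g (h (n + 1)) ∂(M.pathMeasure μ σ) =
      ∫ h, (M.stageLaw σ (n + 1) (fun i => h i) (M.q (h n).1 (h n).2)).expect g
        ∂(M.pathMeasure μ σ) := by
  have key := Kernel.map_frestrictLe_trajMeasure_compProd_eq_map_trajMeasure
    (X := fun _ => M.SA) (μ₀ := (M.stageLaw σ 0 Fin.elim0 μ).toMeasure) (κ := M.stepKernel σ)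
    (a := n)
  rw [← pathMeasure] at key
  have h1 : ∫ h, g (h (n + 1)) ∂(M.pathMeasure μ σ) =
      ∫ y, g y.2 ∂((M.pathMeasure μ σ).map fun x =>
        (Preorder.frestrictLe (π := fun _ => M.SA) n x, x (n + 1))) := by
    rw [integral_map (by fun_prop) Measurable.of_discrete.aestronglyMeasurable]
  have := Measure.isProbabilityMeasure_map (μ := M.pathMeasure μ σ)
    (f := Preorder.frestrictLe (π := fun _ => M.SA) n) (by fun_prop)
  rw [h1, ← key, Measure.integral_compProd (.of_finite), integral_map (by fun_prop)
    Measurable.of_discrete.aestronglyMeasurable]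
  refine integral_congr_ae (.of_forall fun h => ?_)
  exact PMF.integral_toMeasure _ _

lemma hasSum_discountedPayoff {l : ℝ} (h0 : 0 ≤ l) (h1 : l < 1) :
    HasSum (fun n => l ^ n * ∫ h, M.r (h n).1 (h n).2 ∂(M.pathMeasure μ σ))
      (M.discountedPayoff l μ σ) := by
  obtain ⟨C, hC⟩ := (Set.finite_range fun x : M.SA => ‖M.r x.1 x.2‖).bddAbove
  have hb : ∀ n h, ‖l ^ n * M.r ((h : ℕ → M.SA) n).1 (h n).2‖ ≤ l ^ n * C := fun n h => by
    rw [norm_mul, norm_pow, Real.norm_of_nonneg h0]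
    exact mul_le_mul_of_nonneg_left (hC ⟨h n, rfl⟩) (by positivity)
  have hs : Summable fun n => l ^ n * C := (summable_geometric_of_lt_one h0 h1).mul_right C
  have := hasSum_integral_of_summable_integral_norm (μ := M.pathMeasure μ σ)
    (F := fun n h => l ^ n * M.r (h n).1 (h n).2)
    (fun n => (M.integrable_stage μ σ n fun x => M.r x.1 x.2).const_mul _)
    (hs.of_nonneg_of_le (fun n => integral_nonneg fun _ => norm_nonneg _) fun n => by
      refine (integral_mono_of_nonneg (.of_forall fun _ => norm_nonneg _)
        (integrable_const _) (.of_forall (hb n))).trans ?_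
      simp)
  simp only [integral_const_mul] at this
  exact this

/-- The expected gain of a stage, relative to a potential `U` on the states: payoff plus discounted
potential of the next state, minus the potential of the current state. -/
def bellmanGap (l : ℝ) (U : M.S → ℝ) (x : M.SA) : ℝ :=
  M.r x.1 x.2 + l * (M.q x.1 x.2).expect U - U x.1

/-- The discounted payoff is the expected potential of the initial state plus the discounted sum of
the Bellman gaps, as the potentials of the later states telescope. -/
lemma hasSum_bellmanGap {l : ℝ} (h0 : 0 ≤ l) (h1 : l < 1) (U : M.S → ℝ) :
    HasSum (fun n => l ^ n * ∫ h, M.bellmanGap l U (h n) ∂(M.pathMeasure μ σ))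
      (M.discountedPayoff l μ σ - μ.expect U) := by
  set a : ℕ → ℝ := fun n => ∫ h, U (h n).1 ∂(M.pathMeasure μ σ) with ha
  have a0 : a 0 = μ.expect U := by
    change ∫ h : ℕ → M.SA, U (h 0).1 ∂(M.pathMeasure μ σ) = _
    rw [M.integral_stage_zero μ σ fun x => U x.1, stageLaw_expect]; simp
  have asucc : ∀ n, a (n + 1) =
      ∫ h, (M.q (h n).1 (h n).2).expect U ∂(M.pathMeasure μ σ) := fun n => by
    simp only [ha]
    rw [M.integral_stage_succ μ σ n fun x => U x.1]
    simp [stageLaw_expect]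
  have hgap : ∀ n, ∫ h, M.bellmanGap l U (h n) ∂(M.pathMeasure μ σ) =
      ∫ h, M.r (h n).1 (h n).2 ∂(M.pathMeasure μ σ) + l * a (n + 1) - a n := fun n => by
    have i1 := M.integrable_stage μ σ n fun x => M.r x.1 x.2
    have i2 := M.integrable_stage μ σ n fun x => l * (M.q x.1 x.2).expect U
    have i3 := M.integrable_stage μ σ n fun x => U x.1
    simp only [bellmanGap]
    rw [asucc, ← integral_const_mul, ← integral_add i1 i2]
    exact integral_sub (i1.add i2) i3
  have hbound : ∃ C, ∀ n, |a n| ≤ C := by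
    obtain ⟨C, hC⟩ := (Set.finite_range fun s => ‖U s‖).bddAbove
    refine ⟨C, fun n => ?_⟩
    have := norm_integral_le_of_norm_le_const (μ := M.pathMeasure μ σ) (f := fun h => U (h n).1)
      (C := C) (.of_forall fun h => hC ⟨_, rfl⟩)
    simpa using this
  obtain ⟨C, hC⟩ := hbound
  have hs : Summable fun n => l ^ n * a n := by
    refine Summable.of_norm_bounded ((summable_geometric_of_lt_one h0 h1).mul_right C) fun n => ?_
    rw [norm_mul, norm_pow, Real.norm_of_nonneg h0]
    exact mul_le_mul_of_nonneg_left (hC n) (by positivity)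
  have hs' : HasSum (fun n => l ^ (n + 1) * a (n + 1)) ((∑' n, l ^ n * a n) - a 0) := by
    have := (hasSum_nat_add_iff' 1).2 hs.hasSum
    simpa using this
  have key := ((M.hasSum_discountedPayoff μ σ h0 h1).add hs').sub hs.hasSum
  rw [a0, show ∀ x y z : ℝ, x + (z - y) - z = x - y by intros; ring] at key
  refine key.congr_fun fun n => ?_
  rw [hgap]; ring

lemma discountedPayoff_le {l : ℝ} (h0 : 0 ≤ l) (h1 : l < 1) (U : M.S → ℝ)
    (hU : ∀ s a, M.r s a + l * (M.q s a).expect U ≤ U s) :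
    M.discountedPayoff l μ σ ≤ μ.expect U := by
  have hgap : ∀ n, ∫ h, M.bellmanGap l U (h n) ∂(M.pathMeasure μ σ) ≤ 0 := fun n =>
    integral_nonpos fun h => sub_nonpos.2 (hU (h n).1 (h n).2)
  exact sub_nonpos.1 <| hasSum_le (fun n => mul_nonpos_of_nonneg_of_nonpos (pow_nonneg h0 n)
    (hgap n)) (M.hasSum_bellmanGap μ σ h0 h1 U) hasSum_zero

/-- The strategy that plays the action `f s` whenever the current state is `s`. -/
def pureStationary (f : ∀ s, M.A s) : M.BehaviorStrategy := fun _ _ s => PMF.pure (f s)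

lemma discountedPayoff_pureStationary (f : ∀ s, M.A s) {l : ℝ} (h0 : 0 ≤ l) (h1 : l < 1)
    (U : M.S → ℝ) (hU : ∀ s, M.r s (f s) + l * (M.q s (f s)).expect U = U s) :
    M.discountedPayoff l μ (M.pureStationary f) = μ.expect U := by
  have hz : ∀ n, ∫ h, M.bellmanGap l U (h n) ∂(M.pathMeasure μ (M.pureStationary f)) = 0 := by
    have hg : ∀ s, M.bellmanGap l U ⟨s, f s⟩ = 0 := fun s => sub_eq_zero.2 (hU s)
    rintro (_ | n)
    · rw [integral_stage_zero, stageLaw_expect]; simp [pureStationary, hg]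
    · rw [integral_stage_succ]; simp [stageLaw_expect, pureStationary, hg]
  have := M.hasSum_bellmanGap μ (M.pureStationary f) h0 h1 U
  simp only [hz, mul_zero] at this
  linarith [this.unique hasSum_zero]

/-- Bellman's optimality equation has a solution: its right-hand side is a contraction for the
supremum norm. -/
lemma exists_bellman_fixedPoint {l : ℝ} (h0 : 0 ≤ l) (h1 : l < 1) :
    ∃ (V : M.S → ℝ) (f : ∀ s, M.A s),
      (∀ s a, M.r s a + l * (M.q s a).expect V ≤ V s) ∧
      ∀ s, M.r s (f s) + l * (M.q s (f s)).expect V = V s := by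
  let B : (M.S → ℝ) → M.S → ℝ := fun V s =>
    Finset.univ.sup' Finset.univ_nonempty fun a => M.r s a + l * (M.q s a).expect V
  have hle : ∀ V W s, B V s ≤ B W s + l * dist V W := fun V W s => by
    refine Finset.sup'_le _ _ fun a _ => ?_
    have h2 := Finset.le_sup' (fun a => M.r s a + l * (M.q s a).expect W) (Finset.mem_univ a)
    have h3 : (M.q s a).expect V ≤ (M.q s a).expect W + dist V W := by
      have := (M.q s a).expect_mono (f := V) (g := fun t => W t + dist V W) fun t => by
        have := (le_abs_self _).trans (dist_le_pi_dist V W t)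
        linarith
      simpa [PMF.expect_add] using this
    have h4 := mul_le_mul_of_nonneg_left h3 h0
    change _ ≤ Finset.sup' _ _ _ + _
    linarith
  have hB : ContractingWith ⟨l, h0⟩ B := by
    refine ⟨h1, LipschitzWith.of_dist_le_mul fun V W => ?_⟩
    refine (dist_pi_le_iff (by positivity)).2 fun s => ?_
    have h2 := hle V W s
    have h3 := hle W V s
    rw [dist_comm W V] at h3
    change |_| ≤ l * dist V W
    rw [abs_le]
    constructor <;> linarith
  let V := ContractingWith.fixedPoint B hB
  have hV : ∀ s, B V s = V s := fun s => congrFun hB.fixedPoint_isFixedPt s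
  have hf : ∀ s, ∃ a, M.r s a + l * (M.q s a).expect V = V s := fun s => by
    obtain ⟨a, -, ha⟩ := Finset.exists_mem_eq_sup' (Finset.univ_nonempty (α := M.A s))
      fun a => M.r s a + l * (M.q s a).expect V
    exact ⟨a, ha.symm.trans (hV s)⟩
  choose f hf using hf
  exact ⟨V, f, fun s a => (Finset.le_sup' (fun a => M.r s a + l * (M.q s a).expect V)
    (Finset.mem_univ a)).trans (hV s).le, hf⟩

lemma discountedValue_eq {l : ℝ} (h0 : 0 ≤ l) (h1 : l < 1) {V : M.S → ℝ} (f : ∀ s, M.A s)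
    (hV : ∀ s a, M.r s a + l * (M.q s a).expect V ≤ V s)
    (hf : ∀ s, M.r s (f s) + l * (M.q s (f s)).expect V = V s) :
    M.discountedValue l μ = μ.expect V := by
  have hle := fun σ => M.discountedPayoff_le μ σ h0 h1 V hV
  have : Nonempty M.BehaviorStrategy := ⟨M.pureStationary f⟩
  refine le_antisymm (ciSup_le hle) ?_
  rw [← M.discountedPayoff_pureStationary μ f h0 h1 V hf]
  exact le_ciSup (f := fun σ => M.discountedPayoff l μ σ) ⟨_, Set.forall_mem_range.2 hle⟩ _

open Classical in
/-- The discounted value is the largest payoff of a pure stationary strategy. -/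
lemma discountedValue_eq_sup' {l : ℝ} (h0 : 0 ≤ l) (h1 : l < 1) :
    M.discountedValue l μ = Finset.univ.sup' Finset.univ_nonempty fun f : ∀ s, M.A s =>
      M.discountedPayoff l μ (M.pureStationary f) := by
  obtain ⟨V, f, hV, hf⟩ := M.exists_bellman_fixedPoint h0 h1
  rw [M.discountedValue_eq μ h0 h1 f hV hf]
  refine le_antisymm ?_ (Finset.sup'_le _ _ fun g _ => M.discountedPayoff_le μ _ h0 h1 V hV)
  rw [← M.discountedPayoff_pureStationary μ f h0 h1 V hf]
  exact Finset.le_sup' (fun f => M.discountedPayoff l μ (M.pureStationary f)) (Finset.mem_univ f)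

end MDP

/-! ### Real parts of complex polynomials -/

namespace Polynomial

/-- The real polynomial whose coefficients are the real parts of those of `p`. -/
def rePart (p : ℂ[X]) : ℝ[X] := ∑ i ∈ Finset.range (p.natDegree + 1), monomial i (p.coeff i).re

@[simp] lemma coeff_rePart (p : ℂ[X]) (n : ℕ) : p.rePart.coeff n = (p.coeff n).re := by
  simp only [rePart, finsetSum_coeff, coeff_monomial, Finset.sum_ite_eq', Finset.mem_range]
  split_ifs with h
  · rfl
  · rw [coeff_eq_zero_of_natDegree_lt (by omega), Complex.zero_re]

lemma natDegree_rePart_le (p : ℂ[X]) : p.rePart.natDegree ≤ p.natDegree :=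
  natDegree_le_iff_coeff_eq_zero.2 fun n hn => by
    rw [coeff_rePart, coeff_eq_zero_of_natDegree_lt hn, Complex.zero_re]

lemma rePart_map_mul (p : ℝ[X]) (q : ℂ[X]) :
    (p.map (algebraMap ℝ ℂ) * q).rePart = p * q.rePart := by
  ext n
  simp [coeff_mul, coeff_map]

lemma reflect_one_X_sub_C {K : Type*} [Field K] (z : K) (hz : z ≠ 0) :
    reflect 1 (X - C z) = C (-z) * (X - C z⁻¹) := by
  rw [reflect_sub, reflect_one_X, reflect_C, mul_sub, ← C_mul, neg_mul, mul_inv_cancel₀ hz]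
  simp; ring

lemma X_sub_C_inv_sq_dvd_of_dvd_reverse {K : Type*} [Field K] {p : K[X]} (hp : p ≠ 0) {z : K}
    (hz : z ≠ 0) (h : (X - C z) ^ 2 ∣ p.reverse) : (X - C z⁻¹) ^ 2 ∣ p := by
  obtain ⟨q, hq⟩ := h
  have hr : p.reverse ≠ 0 := mt reverse_eq_zero.1 hp
  have hq0 : q ≠ 0 := by rintro rfl; exact hr (by rw [hq, mul_zero])
  have hX : ((X - C z) ^ 2 : K[X]).natDegree = 2 := by
    rw [natDegree_pow, natDegree_X_sub_C]
  have hdeg : 2 + q.natDegree ≤ p.natDegree := by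
    have := p.reverse_natDegree_le
    rwa [hq, natDegree_mul (pow_ne_zero _ (X_sub_C_ne_zero z)) hq0, hX] at this
  have h1 : p = reflect (1 + 1 + (p.natDegree - 2)) ((X - C z) * (X - C z) * q) := by
    rw [← sq, ← hq, show 1 + 1 + (p.natDegree - 2) = p.natDegree by omega, reverse,
      reflect_reflect]
  rw [reflect_mul _ _ (by rw [← sq, hX]) (by omega), reflect_mul _ _ (by simp) (by simp),
    reflect_one_X_sub_C z hz] at h1
  exact ⟨C (-z) * C (-z) * reflect (p.natDegree - 2) q, h1.trans (by ring)⟩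

lemma eval_reverse_eq_sum {R : Type*} [CommSemiring R] (p : R[X]) (x : R) :
    p.reverse.eval x =
      ∑ k ∈ Finset.range (p.natDegree + 1), p.coeff k * x ^ (p.natDegree - k) := by
  rw [eval_eq_sum_range' (Nat.lt_succ_of_le p.reverse_natDegree_le), ← Finset.sum_range_reflect]
  refine Finset.sum_congr rfl fun k hk => ?_
  have hk : k ≤ p.natDegree := Nat.lt_succ_iff.1 (Finset.mem_range.1 hk)
  rw [coeff_reverse, Nat.succ_sub_one, revAt_le (Nat.sub_le _ _), Nat.sub_sub_self hk]

end Polynomial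

/-! ### The peripheral spectrum of a stochastic matrix -/

namespace Matrix

variable {n : Type*} [Fintype n] [DecidableEq n] {A : Matrix n n ℝ}

/-- A real matrix, seen as a complex one. -/
abbrev complexify (A : Matrix n n ℝ) : Matrix n n ℂ := A.map Complex.ofReal

lemma complexify_pow (A : Matrix n n ℝ) (k : ℕ) : A.complexify ^ k = (A ^ k).complexify :=
  (map_pow (Complex.ofRealHom.mapMatrix (m := n)) A k).symm

lemma re_aeval_complexify (p : ℂ[X]) (i j : n) :
    (aeval A.complexify p i j).re = aeval A p.rePart i j := by
  rw [aeval_eq_sum_range, aeval_eq_sum_range' (Nat.lt_succ_of_le p.natDegree_rePart_le)]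
  simp [Matrix.sum_apply, complexify_pow]

lemma aeval_complexify_map (p : ℝ[X]) :
    aeval A.complexify (p.map (algebraMap ℝ ℂ)) = (aeval A p).complexify := by
  rw [aeval_map_algebraMap]
  exact aeval_algHom_apply (Complex.ofRealAm.mapMatrix (m := n)) A p

lemma minpoly_complexify (A : Matrix n n ℝ) :
    minpoly ℂ A.complexify = (minpoly ℝ A).map (algebraMap ℝ ℂ) := by
  have hA : IsIntegral ℝ A := Algebra.IsIntegral.isIntegral A
  have hc : IsIntegral ℂ A.complexify := Algebra.IsIntegral.isIntegral _
  have hmon := minpoly.monic hc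
  refine (eq_of_monic_of_dvd_of_natDegree_le hmon ((minpoly.monic hA).map _)
    (minpoly.dvd _ _ ?_) ?_).symm
  · rw [aeval_complexify_map, minpoly.aeval]
    ext; simp
  · rw [natDegree_map]
    have h0 : (minpoly ℂ A.complexify).rePart ≠ 0 := fun h => by
      have := congrArg (fun q => q.coeff (minpoly ℂ A.complexify).natDegree) h
      simp [hmon.coeff_natDegree] at this
    refine (natDegree_le_of_dvd (minpoly.dvd ℝ A ?_) h0).trans (natDegree_rePart_le _)
    ext i j
    rw [← re_aeval_complexify, minpoly.aeval]
    simp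

lemma norm_complexify_mulVec_le (hA : A ∈ rowStochastic ℝ n) (v : n → ℂ) :
    ‖A.complexify *ᵥ v‖ ≤ ‖v‖ := by
  refine (pi_norm_le_iff_of_nonneg (norm_nonneg v)).2 fun i => ?_
  calc ‖∑ j, (A i j : ℂ) * v j‖ ≤ ∑ j, A i j * ‖v‖ := norm_sum_le_of_le _ fun j _ => by
        rw [norm_mul, Complex.norm_of_nonneg (nonneg_of_mem_rowStochastic hA)]
        exact mul_le_mul_of_nonneg_left (norm_le_pi_norm v j) (nonneg_of_mem_rowStochastic hA)
    _ = ‖v‖ := by rw [← Finset.sum_mul, sum_row_of_mem_rowStochastic hA, one_mul]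

lemma norm_complexify_pow_mulVec_le (hA : A ∈ rowStochastic ℝ n) (v : n → ℂ) (k : ℕ) :
    ‖A.complexify ^ k *ᵥ v‖ ≤ ‖v‖ := by
  rw [complexify_pow]
  exact norm_complexify_mulVec_le (pow_mem hA k) v

/-- At a state where an eigenvector `u` for an eigenvalue `z` of modulus one has maximal modulus,
strict convexity of the disc forces `u` to take the value `z * u i` at every successor. -/
lemma exists_eq_mul_of_mulVec_eq_smul (hA : A ∈ rowStochastic ℝ n) {u : n → ℂ} {z : ℂ}
    (hu : A.complexify *ᵥ u = z • u) (hz : ‖z‖ = 1) {i : n} (hi : ‖u i‖ = ‖u‖) :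
    ∃ j, u j = z * u i := by
  set c := z * u i with hc
  have hcn : Complex.normSq c = ‖u‖ ^ 2 := by
    rw [Complex.normSq_eq_norm_sq, hc, norm_mul, hz, one_mul, hi]
  have hle : ∀ j, 0 ≤ ‖u‖ ^ 2 - (star c * u j).re := fun j => by
    have h1 := Complex.re_le_norm (star c * u j)
    rw [norm_mul, norm_star, hc, norm_mul, hz, one_mul, hi] at h1
    have h2 := mul_le_mul_of_nonneg_left (norm_le_pi_norm u j) (norm_nonneg u)
    nlinarith
  have hsum : ∑ j, A i j * (‖u‖ ^ 2 - (star c * u j).re) = 0 := by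
    have h1 : ∑ j, (A i j : ℂ) * u j = c := congrFun hu i
    have h2 : ∑ j, A i j * (star c * u j).re = ‖u‖ ^ 2 := by
      have : (star c * ∑ j, (A i j : ℂ) * u j).re = ‖u‖ ^ 2 := by
        rw [h1, ← hcn]
        simp [Complex.normSq_apply]
      rw [← this, Finset.mul_sum, Complex.re_sum]
      refine Finset.sum_congr rfl fun j _ => ?_
      rw [mul_left_comm, Complex.re_ofReal_mul]
    simp only [mul_sub, Finset.sum_sub_distrib]
    rw [h2, ← Finset.sum_mul, sum_row_of_mem_rowStochastic hA, one_mul, sub_self]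
  have hz' := (Finset.sum_eq_zero_iff_of_nonneg fun j _ =>
    mul_nonneg (nonneg_of_mem_rowStochastic hA) (hle j)).1 hsum
  obtain ⟨j, -, hj⟩ := Finset.exists_ne_zero_of_sum_ne_zero
    ((sum_row_of_mem_rowStochastic hA i).trans_ne one_ne_zero)
  refine ⟨j, ?_⟩
  have hre : (star c * u j).re = ‖u‖ ^ 2 := by
    have := (mul_eq_zero.1 (hz' j (Finset.mem_univ j))).resolve_left hj
    linarith
  have hn : Complex.normSq (u j) ≤ ‖u‖ ^ 2 := by
    rw [Complex.normSq_eq_norm_sq]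
    exact pow_le_pow_left₀ (norm_nonneg _) (norm_le_pi_norm u j) 2
  have : Complex.normSq (u j - c) ≤ 0 := by
    rw [Complex.normSq_sub, hcn]
    have : (u j * (starRingEnd ℂ) c).re = ‖u‖ ^ 2 := by rw [mul_comm]; exact hre
    linarith
  exact sub_eq_zero.1 (Complex.normSq_eq_zero.1 (le_antisymm this (Complex.normSq_nonneg _)))

/-- An eigenvalue of modulus one permutes the finitely many values of maximal modulus of an
eigenvector, hence is a root of unity. -/
lemma exists_pow_eq_one_of_mulVec_eq_smul (hA : A ∈ rowStochastic ℝ n) {u : n → ℂ} (hu0 : u ≠ 0)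
    {z : ℂ} (hu : A.complexify *ᵥ u = z • u) (hz : ‖z‖ = 1) : ∃ k : ℕ, 0 < k ∧ z ^ k = 1 := by
  have : Nonempty n := by
    by_contra h
    rw [not_nonempty_iff] at h
    exact hu0 (Subsingleton.elim _ _)
  obtain ⟨i, hi⟩ : ∃ i, ‖u i‖ = ‖u‖ := by
    obtain ⟨i, hi⟩ := Finite.exists_max fun i => ‖u i‖
    exact ⟨i, le_antisymm (norm_le_pi_norm u i)
      ((pi_norm_le_iff_of_nonneg (norm_nonneg _)).2 hi)⟩
  have hui : u i ≠ 0 := by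
    rw [← norm_ne_zero_iff, hi]
    exact norm_ne_zero_iff.2 hu0
  have horbit : ∀ k : ℕ, ∃ j, u j = z ^ k * u i := fun k => by
    induction k with
    | zero => exact ⟨i, by simp⟩
    | succ k ih =>
      obtain ⟨j, hj⟩ := ih
      obtain ⟨j', hj'⟩ := exists_eq_mul_of_mulVec_eq_smul hA hu hz (i := j)
        (by rw [hj, norm_mul, norm_pow, hz, one_pow, one_mul, hi])
      exact ⟨j', by rw [hj', hj, pow_succ']; ring⟩
  choose t ht using horbit
  obtain ⟨a, b, hab, htab⟩ := Finite.exists_ne_map_eq_of_infinite t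
  wlog h : a < b generalizing a b
  · exact this b a hab.symm htab.symm (by omega)
  have hz0 : z ≠ 0 := norm_ne_zero_iff.1 (hz.trans_ne one_ne_zero)
  refine ⟨b - a, by omega, mul_left_cancel₀ (pow_ne_zero a hz0) (mul_right_cancel₀ hui ?_)⟩
  rw [← pow_add, Nat.add_sub_cancel' h.le, mul_one, ← ht, ← ht, htab]

/-- A proper factor of the minimal polynomial of a matrix does not annihilate it. -/
lemma exists_aeval_mulVec_ne_zero {B : Matrix n n ℂ} {w : ℂ} {K : ℂ[X]}
    (h : minpoly ℂ B = (X - C w) * K) : ∃ v, aeval B K *ᵥ v ≠ 0 := by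
  have hB : IsIntegral ℂ B := Algebra.IsIntegral.isIntegral B
  have hne : aeval B K ≠ 0 := fun h0 => by
    have hK : K ≠ 0 := by
      rintro rfl
      exact minpoly.ne_zero hB (by rw [h, mul_zero])
    have := natDegree_le_of_dvd (minpoly.dvd ℂ B h0) hK
    rw [h, natDegree_mul (X_sub_C_ne_zero w) hK, natDegree_X_sub_C] at this
    omega
  by_contra! hall
  refine hne (Matrix.mulVec_injective ?_)
  ext v : 1
  rw [hall, zero_mulVec]

lemma mulVec_aeval_X_sub_C_mul (B : Matrix n n ℂ) (w : ℂ) (K : ℂ[X]) (v : n → ℂ) :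
    B *ᵥ (aeval B K *ᵥ v) = w • (aeval B K *ᵥ v) + aeval B ((X - C w) * K) *ᵥ v := by
  rw [map_mul, map_sub, aeval_X, aeval_C, sub_mul, sub_mulVec, ← mulVec_mulVec,
    Algebra.algebraMap_eq_smul_one, smul_mul_assoc, one_mul, smul_mulVec]
  abel

lemma isRoot_minpoly_complexify (hA : A ∈ rowStochastic ℝ n) {w : ℂ}
    (hw : (minpoly ℂ A.complexify).IsRoot w) :
    ‖w‖ ≤ 1 ∧ (‖w‖ = 1 → ∃ k : ℕ, 0 < k ∧ w ^ k = 1) := by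
  obtain ⟨K, hK⟩ := dvd_iff_isRoot.2 hw
  obtain ⟨v, hv⟩ := exists_aeval_mulVec_ne_zero hK
  have hu := mulVec_aeval_X_sub_C_mul A.complexify w K v
  rw [← hK, minpoly.aeval, zero_mulVec, add_zero] at hu
  refine ⟨?_, exists_pow_eq_one_of_mulVec_eq_smul hA hv hu⟩
  have := norm_complexify_mulVec_le hA (aeval A.complexify K *ᵥ v)
  rw [hu, norm_smul] at this
  exact le_of_mul_le_mul_right (by rwa [one_mul]) (norm_pos_iff.2 hv)

/-- Eigenvalues of modulus one are simple roots of the minimal polynomial: on a Jordan block the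
powers of the matrix would grow linearly, whereas they are contractions. -/
lemma not_sq_dvd_minpoly_complexify (hA : A ∈ rowStochastic ℝ n) {w : ℂ} (hw : ‖w‖ = 1) :
    ¬ (X - C w) ^ 2 ∣ minpoly ℂ A.complexify := by
  rintro ⟨K, hK⟩
  rw [sq, mul_assoc] at hK
  obtain ⟨v, hv⟩ := exists_aeval_mulVec_ne_zero hK
  set B := A.complexify
  set u := aeval B K *ᵥ v
  set x := aeval B ((X - C w) * K) *ᵥ v
  have hu : B *ᵥ u = w • u + x := mulVec_aeval_X_sub_C_mul B w K v
  have hx : B *ᵥ x = w • x := by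
    have := mulVec_aeval_X_sub_C_mul B w ((X - C w) * K) v
    rwa [← hK, minpoly.aeval, zero_mulVec, add_zero] at this
  have hpow : ∀ k : ℕ, w • (B ^ k *ᵥ u) = w ^ (k + 1) • u + (k * w ^ k) • x := fun k => by
    induction k with
    | zero => simp
    | succ k ih =>
      rw [pow_succ' B, ← mulVec_mulVec, ← mulVec_smul, ih, mulVec_add, mulVec_smul, mulVec_smul,
        hu, hx, smul_add, smul_smul, smul_smul, add_assoc, ← add_smul]
      congr 2
      push_cast; ring
  have hbound : ∀ k : ℕ, k * ‖x‖ ≤ 2 * ‖u‖ := fun k => by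
    have h1 : (k * w ^ k) • x = w • (B ^ k *ᵥ u) - w ^ (k + 1) • u := by rw [hpow]; abel
    have h2 := norm_sub_le (w • (B ^ k *ᵥ u)) (w ^ (k + 1) • u)
    rw [← h1, norm_smul, norm_smul, norm_smul, norm_mul, norm_pow, norm_pow, hw, one_pow, one_pow,
      mul_one, one_mul, one_mul, Complex.norm_natCast] at h2
    linarith [norm_complexify_pow_mulVec_le hA u k]
  have hx0 : 0 < ‖x‖ := norm_pos_iff.2 hv
  obtain ⟨k, hk⟩ := exists_nat_gt (2 * ‖u‖ / ‖x‖)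
  rw [div_lt_iff₀ hx0] at hk
  exact (hbound k).not_gt hk

end Matrix

/-! ### Payoffs of pure stationary strategies are rational -/

/-- The condition on the denominator of an admissible rational function. -/
def AdmissibleDenominator (Q : ℝ[X]) : Prop :=
  ∀ z : ℂ, (Q.map (algebraMap ℝ ℂ)).IsRoot z →
    1 < ‖z‖ ∨
    ((∃ n : ℕ, 0 < n ∧ z ^ n = 1) ∧ (Q.map (algebraMap ℝ ℂ)).rootMultiplicity z = 1)

lemma AdmissibleDenominator.eval_ne_zero {Q : ℝ[X]} (hQ : AdmissibleDenominator Q) {l : ℝ}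
    (h0 : 0 ≤ l) (h1 : l < 1) : Q.eval l ≠ 0 := fun h => by
  have hroot : (Q.map (algebraMap ℝ ℂ)).IsRoot (l : ℂ) := by
    rw [IsRoot.def, show (l : ℂ) = algebraMap ℝ ℂ l from rfl, eval_map_apply, h, map_zero]
  have hl : ‖(l : ℂ)‖ = l := Complex.norm_of_nonneg h0
  rcases hQ _ hroot with h | ⟨⟨n, hn, h⟩, -⟩
  · linarith
  · have := congrArg norm h
    rw [norm_pow, hl, norm_one] at this
    exact (pow_lt_one₀ h0 h1 hn.ne').ne this

namespace Matrix

variable {n : Type*} [Fintype n] [DecidableEq n] {A : Matrix n n ℝ}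

lemma admissibleDenominator_reverse_minpoly (hA : A ∈ rowStochastic ℝ n) :
    AdmissibleDenominator (minpoly ℝ A).reverse := by
  have hmon : (minpoly ℂ A.complexify).Monic := minpoly.monic (Algebra.IsIntegral.isIntegral _)
  have hrev : (minpoly ℝ A).reverse.map (algebraMap ℝ ℂ) = (minpoly ℂ A.complexify).reverse := by
    rw [minpoly_complexify, reverse, reverse, natDegree_map, reflect_map]
  intro z hz
  rw [hrev] at hz ⊢
  have hz0 : z ≠ 0 := by
    rintro rfl
    rw [IsRoot.def, ← coeff_zero_eq_eval_zero, coeff_zero_reverse, hmon.leadingCoeff] at hz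
    exact one_ne_zero hz
  have hroot : (minpoly ℂ A.complexify).IsRoot z⁻¹ := by
    let _ : Invertible z⁻¹ := invertibleOfNonzero (inv_ne_zero hz0)
    have := eval₂_reverse_eq_zero_iff (RingHom.id ℂ) z⁻¹ (minpoly ℂ A.complexify)
    rw [invOf_eq_inv, inv_inv] at this
    exact this.1 hz
  obtain ⟨hle, hunit⟩ := isRoot_minpoly_complexify hA hroot
  rw [norm_inv] at hle hunit
  have h1 : 1 ≤ ‖z‖ := (inv_le_one₀ (norm_pos_iff.2 hz0)).1 hle
  rcases h1.lt_or_eq with h | h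
  · exact .inl h
  · obtain ⟨k, hk, hzk⟩ := hunit (by rw [← h, inv_one])
    refine .inr ⟨⟨k, hk, by rwa [inv_pow, inv_eq_one] at hzk⟩, ?_⟩
    have hr0 : (minpoly ℂ A.complexify).reverse ≠ 0 := mt reverse_eq_zero.1 hmon.ne_zero
    refine le_antisymm (not_lt.1 fun hlt => ?_) ((rootMultiplicity_pos hr0).2 hz)
    refine not_sq_dvd_minpoly_complexify hA (w := z⁻¹) (by rw [norm_inv, ← h, inv_one]) ?_
    exact X_sub_C_inv_sq_dvd_of_dvd_reverse hmon.ne_zero hz0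
      ((le_rootMultiplicity_iff hr0).1 hlt)

/-- With `m` the minimal polynomial of `A`, of degree `d`, the identity
`m.reverse(l) • 1 = ∑ k, m_k l ^ (d - k) • (1 - (l • A) ^ k)` exhibits a multiple of `1 - l • A`;
its cofactor, applied to `r`, has these polynomial coordinates. -/
def resolventNumerator (A : Matrix n n ℝ) (r : n → ℝ) (i : n) : ℝ[X] :=
  ∑ k ∈ Finset.range ((minpoly ℝ A).natDegree + 1), ∑ j ∈ Finset.range k,
    C ((minpoly ℝ A).coeff k * (A ^ j *ᵥ r) i) * X ^ ((minpoly ℝ A).natDegree - k + j)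

lemma resolventNumerator_spec (A : Matrix n n ℝ) (r : n → ℝ) (l : ℝ) (i : n) :
    (minpoly ℝ A).reverse.eval l * r i +
        l * ∑ j, A i j * (A.resolventNumerator r j).eval l =
      (A.resolventNumerator r i).eval l := by
  set m := minpoly ℝ A
  set d := m.natDegree
  have hP : ∀ j, (A.resolventNumerator r j).eval l =
      ∑ k ∈ Finset.range (d + 1), m.coeff k * l ^ (d - k) *
        ∑ a ∈ Finset.range k, l ^ a * (A ^ a *ᵥ r) j := fun j => by
    simp only [resolventNumerator, eval_finsetSum, eval_mul, eval_C, eval_pow, eval_X,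
      Finset.mul_sum, pow_add]
    exact Finset.sum_congr rfl fun k _ => Finset.sum_congr rfl fun a _ => by ring
  have hAP : l * ∑ j, A i j * (A.resolventNumerator r j).eval l =
      ∑ k ∈ Finset.range (d + 1), m.coeff k * l ^ (d - k) *
        ∑ a ∈ Finset.range k, l ^ (a + 1) * (A ^ (a + 1) *ᵥ r) i := by
    have hstep : ∀ a, (A ^ (a + 1) *ᵥ r) i = ∑ j, A i j * (A ^ a *ᵥ r) j := fun a => by
      rw [pow_succ', ← mulVec_mulVec]; rfl
    simp only [hP, hstep, Finset.mul_sum]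
    rw [Finset.sum_comm]
    refine Finset.sum_congr rfl fun k _ => ?_
    rw [Finset.sum_comm]
    exact Finset.sum_congr rfl fun a _ => Finset.sum_congr rfl fun j _ => by ring
  have hm : ∑ k ∈ Finset.range (d + 1), m.coeff k * (A ^ k *ᵥ r) i = 0 := by
    have : (aeval A m *ᵥ r) i = 0 := by rw [minpoly.aeval]; simp
    rw [aeval_eq_sum_range, sum_mulVec, Finset.sum_apply] at this
    simpa [smul_mulVec] using this
  rw [hAP, hP, eval_reverse_eq_sum, Finset.sum_mul, ← sub_eq_zero, ← Finset.sum_add_distrib,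
    ← Finset.sum_sub_distrib, ← mul_zero (l ^ d), ← hm, Finset.mul_sum]
  refine Finset.sum_congr rfl fun k hk => ?_
  have hk : k ≤ d := Nat.lt_succ_iff.1 (Finset.mem_range.1 hk)
  have htel := Finset.sum_range_sub (fun a => l ^ a * (A ^ a *ᵥ r) i) k
  rw [Finset.sum_sub_distrib] at htel
  have hd : l ^ d = l ^ (d - k) * l ^ k := by rw [← pow_add, Nat.sub_add_cancel hk]
  simp only [pow_zero, one_mulVec, one_mul] at htel
  rw [hd]
  linear_combination m.coeff k * l ^ (d - k) * htel

end Matrix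

namespace MDP

lemma discountedPayoff_pureStationary_mem (M : MDP) (μ : PMF M.S) (f : ∀ s, M.A s) :
    (fun l : Set.Ico (0 : ℝ) 1 => M.discountedPayoff l μ (M.pureStationary f)) ∈
      admissibleRationalFunctions := by
  classical
  let A : Matrix M.S M.S ℝ := .of fun s t => (M.q s (f s) t).toReal
  have hA : A ∈ Matrix.rowStochastic ℝ M.S := Matrix.mem_rowStochastic_iff_sum.2
    ⟨fun s t => ENNReal.toReal_nonneg, fun s => (M.q s (f s)).sum_toReal⟩
  have hQ := Matrix.admissibleDenominator_reverse_minpoly hA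
  let r : M.S → ℝ := fun s => M.r s (f s)
  refine ⟨∑ s, C (μ s).toReal * A.resolventNumerator r s, (minpoly ℝ A).reverse,
    mt reverse_eq_zero.1 (minpoly.ne_zero (Algebra.IsIntegral.isIntegral A)), hQ, ?_⟩
  rintro ⟨l, h0, h1⟩
  have hne := hQ.eval_ne_zero h0 h1
  change M.discountedPayoff l μ _ = _
  rw [M.discountedPayoff_pureStationary μ f h0 h1
    fun s => (A.resolventNumerator r s).eval l / (minpoly ℝ A).reverse.eval l]
  · simp only [PMF.expect, eval_finsetSum, eval_mul, eval_C, Finset.sum_div, mul_div_assoc]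
  · intro s
    rw [eq_div_iff hne, ← A.resolventNumerator_spec r l s]
    simp only [PMF.expect, ← mul_div_assoc, ← Finset.sum_div]
    field_simp
    rw [mul_comm (M.r s (f s))]
    rfl

/-- Value functions are maxima of admissible rational functions: one function for each pure
stationary strategy. -/
lemma valueFunctions_subset : valueFunctions ⊆ maxAdmissibleRationalFunctions := by
  classical
  rintro w ⟨M, μ, hw⟩
  refine ⟨Finset.univ.image fun (f : ∀ s, M.A s) (l : Set.Ico (0 : ℝ) 1) =>
    M.discountedPayoff l μ (M.pureStationary f), Finset.univ_nonempty.image _, ?_, fun l => ?_⟩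
  · simp only [Finset.mem_image, Finset.mem_univ, true_and, forall_exists_index]
    rintro _ f rfl
    exact M.discountedPayoff_pureStationary_mem μ f
  · rw [hw, M.discountedValue_eq_sup' μ l.2.1 l.2.2, Finset.sup'_image]
    congr!

end MDP

/-! ### The sum of the moduli of the coefficients of a polynomial -/

namespace Polynomial

variable {K : Type*} [NormedField K]

/-- The real polynomial whose coefficients are the norms of those of `p`. -/
def absCoeff (p : K[X]) : ℝ[X] := ∑ i ∈ Finset.range (p.natDegree + 1), monomial i ‖p.coeff i‖

@[simp] lemma coeff_absCoeff (p : K[X]) (n : ℕ) : p.absCoeff.coeff n = ‖p.coeff n‖ := by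
  simp only [absCoeff, finsetSum_coeff, coeff_monomial, Finset.sum_ite_eq', Finset.mem_range]
  split_ifs with h
  · rfl
  · rw [coeff_eq_zero_of_natDegree_lt (by omega), norm_zero]

/-- The `ℓ¹` norm of the coefficients, as the value of `p.absCoeff` at `1`, so that it inherits
submultiplicativity from the multiplicativity of evaluation. -/
def coeffNorm (p : K[X]) : ℝ := p.absCoeff.eval 1

lemma eval_one_mono {p q : ℝ[X]} (h : ∀ n, p.coeff n ≤ q.coeff n) : p.eval 1 ≤ q.eval 1 := by
  have hp : p.natDegree < max p.natDegree q.natDegree + 1 := by omega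
  have hq : q.natDegree < max p.natDegree q.natDegree + 1 := by omega
  rw [eval_eq_sum_range' hp, eval_eq_sum_range' hq]
  simpa using Finset.sum_le_sum fun n _ => h n

lemma coeffNorm_eq_sum (p : K[X]) {N : ℕ} (hN : p.natDegree < N) :
    p.coeffNorm = ∑ i ∈ Finset.range N, ‖p.coeff i‖ := by
  have : p.absCoeff.natDegree ≤ p.natDegree := natDegree_le_iff_coeff_eq_zero.2 fun n hn => by
    rw [coeff_absCoeff, coeff_eq_zero_of_natDegree_lt hn, norm_zero]
  rw [coeffNorm, eval_eq_sum_range' (this.trans_lt hN)]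
  simp

lemma coeffNorm_add_le (p q : K[X]) : (p + q).coeffNorm ≤ p.coeffNorm + q.coeffNorm := by
  rw [coeffNorm, coeffNorm, coeffNorm, ← eval_add]
  exact eval_one_mono fun n => by simpa using norm_add_le _ _

lemma coeffNorm_neg (p : K[X]) : (-p).coeffNorm = p.coeffNorm := by
  rw [coeffNorm, coeffNorm]
  congr 1
  ext n
  simp

lemma coeffNorm_mul_le (p q : K[X]) : (p * q).coeffNorm ≤ p.coeffNorm * q.coeffNorm := by
  rw [coeffNorm, coeffNorm, coeffNorm, ← eval_mul]
  refine eval_one_mono fun n => ?_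
  simp only [coeff_absCoeff, coeff_mul]
  exact norm_sum_le_of_le _ fun i _ => (norm_mul _ _).le

lemma coeffNorm_C_mul_X_pow (c : K) (n : ℕ) : (C c * X ^ n).coeffNorm = ‖c‖ := by
  rw [coeffNorm_eq_sum _ (Nat.lt_succ_of_le (natDegree_C_mul_X_pow_le c n)),
    Finset.sum_eq_single n] <;> simp +contextual [coeff_X_pow]

lemma norm_eval_le_coeffNorm (p : K[X]) {x : K} (hx : ‖x‖ ≤ 1) : ‖p.eval x‖ ≤ p.coeffNorm := by
  rw [coeffNorm_eq_sum p (Nat.lt_succ_self _), eval_eq_sum_range]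
  refine norm_sum_le_of_le _ fun i _ => ?_
  rw [norm_mul, norm_pow]
  exact mul_le_of_le_one_right (norm_nonneg _) (pow_le_one₀ (norm_nonneg _) hx)

lemma coeffNorm_rePart_le (p : ℂ[X]) : p.rePart.coeffNorm ≤ p.coeffNorm :=
  eval_one_mono fun n => by simpa using Complex.abs_re_le_norm (p.coeff n)

/-! ### Multiples of admissible denominators -/

/-- A polynomial with all roots outside the unit disc divides a small perturbation of `1`, since
`1 - X / z` divides `1 - (X / z) ^ N` for every `N`. -/
lemma exists_prod_X_sub_C_mul_eq_one_sub (s : Multiset ℂ) (hs : ∀ z ∈ s, 1 < ‖z‖) :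
    ∀ ε : ℝ, 0 < ε → ∃ H a : ℂ[X], (s.map fun z => X - C z).prod * H = 1 - a ∧
      a.coeff 0 = 0 ∧ a.coeffNorm ≤ ε := by
  induction s using Multiset.induction_on with
  | empty =>
    refine fun ε hε => ⟨1, 0, by simp, by simp, ?_⟩
    simpa [coeffNorm, absCoeff] using hε.le
  | cons z s ih =>
    intro ε hε
    have hz : 1 < ‖z‖ := hs z (Multiset.mem_cons_self z s)
    have hz0 : z ≠ 0 := norm_pos_iff.1 (one_pos.trans hz)
    -- With `δ ≤ 1` the error `a + b - a * b` of a product has norm at most `3 * δ ≤ ε`.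
    set δ := min ε 1 / 3 with hδ
    have hδ0 : 0 < δ := by positivity
    have hδ1 : δ ≤ 1 := by linarith [min_le_right ε 1]
    have hδε : 3 * δ ≤ ε := by linarith [min_le_left ε 1]
    obtain ⟨H, a, hH, ha0, ha⟩ := ih (fun w hw => hs w (Multiset.mem_cons_of_mem hw)) δ hδ0
    obtain ⟨N, hN⟩ := exists_pow_lt_of_lt_one hδ0 (inv_lt_one_of_one_lt₀ hz)
    set b : ℂ[X] := C (z⁻¹ ^ (N + 1)) * X ^ (N + 1) with hb
    have hbn : b.coeffNorm ≤ δ := by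
      rw [hb, coeffNorm_C_mul_X_pow, norm_pow, norm_inv]
      exact (pow_le_pow_of_le_one (by positivity) (inv_le_one_of_one_le₀ hz.le)
        N.le_succ).trans hN.le
    have hb0 : b.coeff 0 = 0 := by simp [hb]
    obtain ⟨G, hG⟩ : X - C z ∣ 1 - b := by
      rw [dvd_iff_isRoot, IsRoot.def, hb]
      simp [hz0]
    refine ⟨G * H, a + b + -(a * b), ?_, by simp [mul_coeff_zero, ha0, hb0], ?_⟩
    · rw [Multiset.map_cons, Multiset.prod_cons]
      linear_combination (G * (X - C z)) * hH - (1 - a) * hG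
    · have h1 := coeffNorm_add_le (a + b) (-(a * b))
      have h2 := coeffNorm_add_le a b
      have h3 := coeffNorm_mul_le a b
      have h4 : a.coeffNorm * b.coeffNorm ≤ 1 * δ := by
        have hb' : 0 ≤ b.coeffNorm := by
          rw [hb, coeffNorm_C_mul_X_pow]; positivity
        exact mul_le_mul (ha.trans hδ1) hbn hb' zero_le_one
      rw [coeffNorm_neg] at h1
      linarith

end Polynomial

lemma Multiset.exists_common_pow_eq_one (s : Multiset ℂ)
    (hs : ∀ z ∈ s, ∃ n : ℕ, 0 < n ∧ z ^ n = 1) : ∃ n : ℕ, 0 < n ∧ ∀ z ∈ s, z ^ n = 1 := by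
  induction s using Multiset.induction_on with
  | empty => exact ⟨1, one_pos, by simp⟩
  | cons z s ih =>
    obtain ⟨m, hm, hz⟩ := hs z (Multiset.mem_cons_self z s)
    obtain ⟨n, hn, h⟩ := ih fun w hw => hs w (Multiset.mem_cons_of_mem hw)
    refine ⟨m * n, Nat.mul_pos hm hn, fun w hw => ?_⟩
    rcases Multiset.mem_cons.1 hw with rfl | hw
    · rw [pow_mul, hz, one_pow]
    · rw [mul_comm, pow_mul, h w hw, one_pow]

/-- An admissible denominator divides a product `(X ^ n - 1) * (1 - b)`: its roots of unity, being
simple, are taken care of by the first factor, and its other roots by the second one. -/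
lemma AdmissibleDenominator.exists_dvd {Q : ℝ[X]} (hQ0 : Q ≠ 0) (hQ : AdmissibleDenominator Q) :
    ∃ (n : ℕ) (b : ℝ[X]), 0 < n ∧ b.coeff 0 = 0 ∧ b.coeffNorm ≤ 1 / 2 ∧
      Q ∣ (X ^ n - 1) * (1 - b) := by
  classical
  set p := Q.map (algebraMap ℝ ℂ) with hp
  have hp0 : p ≠ 0 := (Polynomial.map_ne_zero_iff (algebraMap ℝ ℂ).injective).2 hQ0
  set s := p.roots.filter fun z => 1 < ‖z‖
  set t := p.roots.filter fun z => ¬ 1 < ‖z‖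
  have ht : ∀ z ∈ t, (∃ n : ℕ, 0 < n ∧ z ^ n = 1) ∧ p.rootMultiplicity z = 1 := fun z hz => by
    obtain ⟨hz, hn⟩ := Multiset.mem_filter.1 hz
    exact (hQ z (isRoot_of_mem_roots hz)).resolve_left hn
  have hnodup : t.Nodup := Multiset.nodup_iff_count_le_one.2 fun z => by
    by_cases hz : z ∈ t
    · refine (Multiset.count_le_of_le z (Multiset.filter_le _ _)).trans ?_
      rw [count_roots, (ht z hz).2]
    · rw [Multiset.count_eq_zero_of_notMem hz]; exact zero_le_one
  obtain ⟨n, hn, htn⟩ := t.exists_common_pow_eq_one fun z hz => (ht z hz).1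
  obtain ⟨H, a, hH, ha0, ha⟩ := exists_prod_X_sub_C_mul_eq_one_sub s
    (fun z hz => (Multiset.mem_filter.1 hz).2) (1 / 2) (by norm_num)
  have hX : (X ^ n - 1 : ℂ[X]) ≠ 0 := X_pow_sub_C_ne_zero hn 1
  obtain ⟨G, hG⟩ : (t.map fun z => X - C z).prod ∣ (X ^ n - 1 : ℂ[X]) := by
    refine (Multiset.prod_X_sub_C_dvd_iff_le_roots hX t).2
      ((Multiset.le_iff_subset hnodup).2 fun z hz => (mem_roots hX).2 ?_)
    simp [htn z hz]
  have hfac : p = C p.leadingCoeff * ((s.map fun z => X - C z).prod *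
      (t.map fun z => X - C z).prod) := by
    rw [← Multiset.prod_add, ← Multiset.map_add, Multiset.filter_add_not]
    exact (IsAlgClosed.splits p).eq_prod_roots
  have hc : C p.leadingCoeff * C (p.leadingCoeff)⁻¹ = 1 := by
    rw [← C_mul, mul_inv_cancel₀ (leadingCoeff_ne_zero.2 hp0), C_1]
  have hmul : p * (C (p.leadingCoeff)⁻¹ * G * H) =
      (X ^ n - 1 : ℝ[X]).map (algebraMap ℝ ℂ) * (1 - a) := by
    rw [Polynomial.map_sub, Polynomial.map_pow, map_X, Polynomial.map_one, hG, ← hH]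
    set A := (s.map fun z => X - C z).prod
    set B := (t.map fun z => X - C z).prod
    linear_combination (C (p.leadingCoeff)⁻¹ * G * H) * hfac + (A * B * G * H) * hc
  refine ⟨n, a.rePart, hn, by simp [ha0], (coeffNorm_rePart_le a).trans ha,
    (C (p.leadingCoeff)⁻¹ * G * H).rePart, ?_⟩
  have h1 : (1 - a).rePart = 1 - a.rePart := by
    ext k
    by_cases hk : k = 0 <;> simp [coeff_one, hk]
  rw [← rePart_map_mul, ← hp, hmul, rePart_map_mul, h1]

/-! ### Payoffs of finite Markov chains -/

/-- The functions on `[0, 1)` that are the discounted payoff of a finite Markov chain with payoffs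
`r`, as a function of the discount factor, from some initial state. The discounted payoff `U` of the
chain is described by its recursive equation, which determines it. -/
def chainPayoffs : Set (Set.Ico (0 : ℝ) 1 → ℝ) :=
  {f | ∃ (S : Type) (_ : Fintype S) (q : S → PMF S) (r : S → ℝ) (s₀ : S),
    ∀ l : Set.Ico (0 : ℝ) 1, ∃ U : S → ℝ, U s₀ = f l ∧ ∀ s, r s + l * (q s).expect U = U s}

namespace chainPayoffs

lemma const_mul {f : Set.Ico (0 : ℝ) 1 → ℝ} (hf : f ∈ chainPayoffs) (c : ℝ) :
    (fun l => c * f l) ∈ chainPayoffs := by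
  obtain ⟨S, _, q, r, s₀, h⟩ := hf
  refine ⟨S, inferInstance, q, fun s => c * r s, s₀, fun l => ?_⟩
  obtain ⟨U, hU₀, hU⟩ := h l
  refine ⟨fun s => c * U s, by simp only [hU₀], fun s => ?_⟩
  simp only [PMF.expect_const_mul, ← hU s]
  ring

lemma coe_mul {f : Set.Ico (0 : ℝ) 1 → ℝ} (hf : f ∈ chainPayoffs) :
    (fun l : Set.Ico (0 : ℝ) 1 => (l : ℝ) * f l) ∈ chainPayoffs := by
  obtain ⟨S, _, q, r, s₀, h⟩ := hf
  refine ⟨Option S, inferInstance, fun s => s.elim (PMF.pure (some s₀)) fun s => (q s).map some,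
    fun s => s.elim 0 r, none, fun l => ?_⟩
  obtain ⟨U, hU₀, hU⟩ := h l
  refine ⟨fun s => s.elim (l * f l) U, rfl, ?_⟩
  rintro (_ | s)
  · simp [hU₀]
  · simpa using hU s

/-- A fair coin toss selects one of two chains, whose payoffs are doubled. The payoff of the first
stage is collected at the new initial state, which plays the role of both initial states. -/
lemma add {f g : Set.Ico (0 : ℝ) 1 → ℝ} (hf : f ∈ chainPayoffs) (hg : g ∈ chainPayoffs) :
    (fun l => f l + g l) ∈ chainPayoffs := by
  obtain ⟨S, _, q, r, s₀, h⟩ := hf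
  obtain ⟨T, _, q', r', t₀, h'⟩ := hg
  refine ⟨Option (S ⊕ T), inferInstance,
    fun s => s.elim ((PMF.uniformOfFintype Bool).bind fun b =>
        bif b then (q s₀).map (some ∘ .inl) else (q' t₀).map (some ∘ .inr))
      (Sum.elim (fun s => (q s).map (some ∘ .inl)) fun t => (q' t).map (some ∘ .inr)),
    fun s => s.elim (r s₀ + r' t₀) (Sum.elim (fun s => 2 * r s) fun t => 2 * r' t),
    none, fun l => ?_⟩
  obtain ⟨U, hU₀, hU⟩ := h l
  obtain ⟨V, hV₀, hV⟩ := h' l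
  refine ⟨fun s => s.elim (f l + g l) (Sum.elim (fun s => 2 * U s) fun t => 2 * V t), rfl, ?_⟩
  have hcoin : ∀ x : Bool → ℝ,
      (PMF.uniformOfFintype Bool).expect x = (x true + x false) / 2 := fun x => by
    simp [PMF.expect]; ring
  rintro (_ | s | t)
  · simp only [Option.elim_none, PMF.expect_bind, hcoin, cond_true, cond_false, PMF.expect_map,
      Function.comp, Option.elim_some, Sum.elim_inl, Sum.elim_inr, PMF.expect_const_mul]
    rw [← hU₀, ← hV₀, ← hU s₀, ← hV t₀]
    ring
  · simp only [Option.elim_some, Sum.elim_inl, PMF.expect_map, Function.comp,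
      PMF.expect_const_mul, ← hU s]
    ring
  · simp only [Option.elim_some, Sum.elim_inr, PMF.expect_map, Function.comp,
      PMF.expect_const_mul, ← hV t]
    ring

lemma eval_mul {f : Set.Ico (0 : ℝ) 1 → ℝ} (hf : f ∈ chainPayoffs) (P : ℝ[X]) :
    (fun l : Set.Ico (0 : ℝ) 1 => P.eval (l : ℝ) * f l) ∈ chainPayoffs := by
  induction P using Polynomial.induction_on' with
  | add p q hp hq => simpa only [eval_add, add_mul] using add hp hq
  | monomial n c =>
    have h : (fun l : Set.Ico (0 : ℝ) 1 => (l : ℝ) ^ n * f l) ∈ chainPayoffs := by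
      induction n with
      | zero => simpa using hf
      | succ n ih => simpa only [pow_succ', mul_assoc] using coe_mul ih
    simpa only [eval_monomial, mul_assoc] using const_mul h c

end chainPayoffs

lemma PMF.exists_expect_eq_sum {α : Type*} [Fintype α] (w : α → ℝ) (h0 : ∀ a, 0 ≤ w a)
    (h1 : ∑ a, w a = 1) : ∃ p : PMF α, ∀ f : α → ℝ, p.expect f = ∑ a, w a * f a := by
  refine ⟨PMF.ofFintype (fun a => ENNReal.ofReal (w a)) ?_, fun f => ?_⟩
  · rw [← ENNReal.ofReal_sum_of_nonneg fun a _ => h0 a, h1, ENNReal.ofReal_one]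
  · simp [PMF.expect, ENNReal.toReal_ofReal (h0 _)]

/-- A chain that realizes `f = 1 / (1 - b)` through the recursion `f = 1 + ∑ k, b_k l ^ k f`. The
state `(k, e)` has payoff `e l ^ k f`, with a sign `e`: if `k > 0`, the chain waits one stage and
moves to `(k - 1, e)`; at `(0, e)` it gets `e` and moves to `(k, e * sign b_(k + 1))` with
probability `|b_(k + 1)|`. The remaining probability goes to `(0, 0)`, whose payoff is `0`. -/
lemma inv_one_sub_eval_mem_chainPayoffs {b : ℝ[X]} (hb0 : b.coeff 0 = 0) (hb : b.coeffNorm ≤ 1)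
    (hne : ∀ l : Set.Ico (0 : ℝ) 1, 1 - b.eval (l : ℝ) ≠ 0) :
    (fun l : Set.Ico (0 : ℝ) 1 => (1 - b.eval (l : ℝ))⁻¹) ∈ chainPayoffs := by
  set d := b.natDegree
  have hd : b.natDegree < d + 1 + 1 := by omega
  have hsum : ∑ k : Fin (d + 1), |b.coeff (k + 1)| ≤ 1 := by
    rw [coeffNorm_eq_sum b hd, Finset.sum_range_succ', hb0, norm_zero, add_zero,
      ← Fin.sum_univ_eq_sum_range (fun k => ‖b.coeff (k + 1)‖)] at hb
    exact hb
  have heval : ∀ x : ℝ, b.eval x = ∑ k : Fin (d + 1), b.coeff (k + 1) * x ^ ((k : ℕ) + 1) :=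
    fun x => by
      rw [eval_eq_sum_range' hd, Finset.sum_range_succ', hb0, zero_mul, add_zero,
        ← Fin.sum_univ_eq_sum_range (fun k => b.coeff (k + 1) * x ^ (k + 1))]
  obtain ⟨p, hp⟩ := PMF.exists_expect_eq_sum
    (fun o : Option (Fin (d + 1)) => o.elim (1 - ∑ k : Fin (d + 1), |b.coeff (k + 1)|)
      fun k => |b.coeff (k + 1)|)
    (by rintro (_ | k)
        · exact sub_nonneg.2 hsum
        · exact abs_nonneg _)
    (by simp [Fintype.sum_option])
  refine ⟨Fin (d + 1) × SignType, inferInstance,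
    fun s => Fin.cases
      (p.map fun o => o.elim (0, 0) fun k => (k, s.2 * SignType.sign (b.coeff (k + 1))))
      (fun j => PMF.pure (j.castSucc, s.2)) s.1,
    fun s => if s.1 = 0 then s.2 else 0, (0, 1), fun l => ?_⟩
  set F := (1 - b.eval (l : ℝ))⁻¹ with hF
  refine ⟨fun s => s.2 * (l : ℝ) ^ (s.1 : ℕ) * F, by simp [hF], ?_⟩
  rintro ⟨k, e⟩
  induction k using Fin.cases with
  | zero =>
    have hterm : ∀ k : Fin (d + 1), |b.coeff (k + 1)| *
        (((e * SignType.sign (b.coeff (k + 1)) : SignType) : ℝ) * (l : ℝ) ^ (k : ℕ) * F) =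
        e * F * (b.coeff (k + 1) * (l : ℝ) ^ (k : ℕ)) := fun k => by
      have := sign_mul_abs (b.coeff (k + 1))
      rw [SignType.coe_mul]
      linear_combination (e * (l : ℝ) ^ (k : ℕ) * F) * this
    have hFeq : 1 + b.eval (l : ℝ) * F = F := by
      have := mul_inv_cancel₀ (hne l)
      rw [← hF] at this
      linear_combination -this
    simp only [Fin.cases_zero, PMF.expect_map, hp, Fintype.sum_option, Option.elim_none,
      Option.elim_some, hterm, ← Finset.mul_sum]
    rw [heval] at hFeq
    simp only [pow_succ, ← mul_assoc, ← Finset.sum_mul] at hFeq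
    simp
    linear_combination (e : ℝ) * hFeq
  | succ j =>
    simp [Fin.succ_ne_zero, pow_succ]
    ring

/-- After passing to a multiple of the denominator, a partial fraction decomposition reduces an
admissible rational function to the denominators `1 - X ^ n` and `1 - b`. -/
lemma admissibleRationalFunctions_subset_chainPayoffs :
    admissibleRationalFunctions ⊆ chainPayoffs := by
  rintro f ⟨P, Q, hQ0, hQ, hf⟩
  obtain ⟨n, b, hn, hb0, hb, G, hG⟩ := AdmissibleDenominator.exists_dvd hQ0 hQ
  have hcop : IsCoprime (X ^ n - 1 : ℝ[X]) (1 - b) := by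
    refine (isCoprime_iff_aeval_ne_zero_of_isAlgClosed ℝ ℂ _ _).2 fun z => ?_
    by_contra! h
    obtain ⟨h1, h2⟩ := h
    have hz : z ^ n = 1 := by simpa [sub_eq_zero] using h1
    have hbz : (b.map (algebraMap ℝ ℂ)).eval z = 1 := by
      rw [eval_map_algebraMap]
      simpa [sub_eq_zero, eq_comm (a := (1 : ℂ))] using h2
    have h3 := norm_eval_le_coeffNorm (b.map (algebraMap ℝ ℂ))
      (Complex.norm_eq_one_of_pow_eq_one hz hn.ne').le
    have h4 : (b.map (algebraMap ℝ ℂ)).coeffNorm = b.coeffNorm := by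
      rw [coeffNorm, coeffNorm]
      congr 1
      ext k
      simp
    rw [hbz, norm_one, h4] at h3
    linarith
  obtain ⟨u, v, huv⟩ := hcop
  have hb1 : ∀ l : Set.Ico (0 : ℝ) 1, 1 - b.eval (l : ℝ) ≠ 0 := fun l h => by
    have := norm_eval_le_coeffNorm b (x := (l : ℝ))
      (by rw [Real.norm_of_nonneg l.2.1]; exact l.2.2.le)
    rw [← sub_eq_zero.1 h, norm_one] at this
    linarith
  have hX1 : ∀ l : Set.Ico (0 : ℝ) 1, 1 - (X ^ n : ℝ[X]).eval (l : ℝ) ≠ 0 := fun l => by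
    rw [eval_pow, eval_X]
    exact (sub_pos.2 (pow_lt_one₀ l.2.1 l.2.2 hn.ne')).ne'
  have hXn : (X ^ n : ℝ[X]).coeffNorm ≤ 1 := by
    have := coeffNorm_C_mul_X_pow (1 : ℝ) n
    rw [C_1, one_mul, norm_one] at this
    exact this.le
  have m1 := chainPayoffs.eval_mul
    (inv_one_sub_eval_mem_chainPayoffs hb0 (by linarith) hb1) (P * G * u)
  have m2 := chainPayoffs.eval_mul
    (inv_one_sub_eval_mem_chainPayoffs (b := X ^ n) (by simp [hn.ne]) hXn hX1) (-(P * G * v))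
  convert chainPayoffs.add m1 m2 using 1
  ext l
  have hQl := AdmissibleDenominator.eval_ne_zero hQ l.2.1 l.2.2
  have e1 := congrArg (Polynomial.eval (l : ℝ)) hG
  have e2 := congrArg (Polynomial.eval (l : ℝ)) huv
  have hb1 := hb1 l
  have hX1 := hX1 l
  simp only [Polynomial.eval_mul, eval_add, eval_sub, eval_neg, eval_one] at e1 e2 ⊢
  rw [hf l]
  field_simp
  linear_combination P.eval (l : ℝ) * G.eval (l : ℝ) * Q.eval (l : ℝ) * e2 -
    P.eval (l : ℝ) * e1

/-! ### Maxima of payoffs of Markov chains -/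

/-- In the decision process that realizes a maximum of payoffs of Markov chains, the action at the
initial state selects a chain, and collects the payoff of its first stage; the actions at the other
states have no effect. -/
lemma maxAdmissibleRationalFunctions_subset :
    maxAdmissibleRationalFunctions ⊆ valueFunctions := by
  rintro w ⟨F, hF, hFadm, hw⟩
  have hchain : ∀ f : F, (f : Set.Ico (0 : ℝ) 1 → ℝ) ∈ chainPayoffs := fun f =>
    admissibleRationalFunctions_subset_chainPayoffs (hFadm f f.2)
  choose S finS q r s₀ hU using hchain
  have : Nonempty F := hF.to_subtype
  let M : MDP :=
    { S := Option (Σ f : F, S f)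
      A := fun _ => F
      r := fun s g => s.elim (r g (s₀ g)) fun s => r s.1 s.2
      q := fun s g => s.elim ((q g (s₀ g)).map fun t => some ⟨g, t⟩)
        fun s => (q s.1 s.2).map fun t => some ⟨s.1, t⟩ }
  refine ⟨M, PMF.pure none, fun l => ?_⟩
  choose U hU₀ hU using fun f => hU f l
  obtain ⟨g, hgF, hg⟩ := F.exists_mem_eq_sup' hF fun f => f l
  have hroot : ∀ f : F, r f (s₀ f) + (l : ℝ) * (q f (s₀ f)).expect (U f) = f.1 l := fun f =>
    (hU f (s₀ f)).trans (hU₀ f)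
  rw [hw, M.discountedValue_eq (PMF.pure none) l.2.1 l.2.2
    (V := fun s => s.elim (F.sup' hF fun f => f l) fun s => U s.1 s.2) (fun _ => ⟨g, hgF⟩)]
  · exact (PMF.expect_pure (α := Option (Σ f : F, S f)) none
      fun s => s.elim (F.sup' hF fun f => f l) fun s => U s.1 s.2).symm
  · rintro (_ | s) f
    · refine le_of_eq_of_le ?_ (F.le_sup' (fun f => f l) f.2)
      simpa [M] using hroot f
    · simpa [M] using (hU s.1 s.2).le
  · rintro (_ | s)
    · simpa [M, hg] using hroot ⟨g, hgF⟩
    · simpa [M] using hU s.1 s.2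

theorem theorem1 (w : Set.Ico (0 : ℝ) 1 → ℝ) :
    w ∈ valueFunctions ↔ w ∈ maxAdmissibleRationalFunctions :=
  ⟨fun h => MDP.valueFunctions_subset h, fun h => maxAdmissibleRationalFunctions_subset h⟩

end
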